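/- Conventions. Let $X$ be a nonempty second countable locally compact Hausdorff space, and let $D$ be a second countable locally compact Hausdorff space. Both carry their Borel $\sigma$-algebras. A hypergroup structure $(D,*)$ is a bilinear associative multiplication $*$ on the space $M_b(D)$ of complex Borel measures. It maps pairs of positive measures to positive measures and is jointly weakly continuous on pairs of positive measures (weak meaning: tested against bounded continuous functions). Moreover: 1. for $x,y\in D$, $\delta_x*\delta_y$ is a probability measure with compact support, and this support depends continuously on $(x,y)$ in the Michael (Vietoris) topology; 2. there is $e\in D$ with $\delta_x*\delta_e=\delta_e*\delta_x=\delta_x$ for all $x\in D$; 3. there is a continuous involution $x\mapsto\bar x$ on $D$ such that $e\in\operatorname{supp}(\delta_x*\delta_y)$ if and only if $y=\bar x$; 4. the image of $\delta_x*\delta_y$ under the involution is $\delta_{\bar y}*\delta_{\bar x}$. A continuous association scheme (CAS) $(X,D,K)$ consists of such $X,D$ and a Markov kernel $K$ from $X\times D$ to $X$, with $K_h(x,A)=K(x,h;A)$ and $T_hf(x)=\int_X f\,dK(x,h;\cdot)$, such that $(x,h)\mapsto T_hf(x)$ is continuous for each bounded continuous $f:X\to\mathbb C$, and such that: 1. each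 $\operatorname{supp}K(x,h;\cdot)$ is compact and depends continuously on $(x,h)$ in the Hausdorff topology on compact sets; 2. for each $x\in X$ the sets $\operatorname{supp}K(x,h;\cdot)$, $h\in D$, form a partition of $X$, and the unique map $\pi:X\times X\to D$ with $y\in\operatorname{supp}K(x,\pi(x,y);\cdot)$ for all $x,y$ is continuous; 3. $D$ carries a hypergroup structure $(D,*)$, called the associated one, with $$\int_X K_{h_2}(y,A)\,K_{h_1}(x,dy)=\int_D K_h(x,A)\,d(\delta_{h_1}*\delta_{h_2})(h)$$ for all $h_1,h_2\in D$, $x\in X$ and Borel sets $A\subset X$, and its identity $e$ satisfies $K(x,e;\cdot)=\delta_x$ for all $x\in X$; 4. there is a positive Radon measure $\omega_X$ on $X$ with $\operatorname{supp}\omega_X=X$ and $$\int_X T_{\bar h}f\cdot g\,d\omega_X=\int_X f\cdot T_hg\,d\omega_X$$ for all $h\in D$ and $f,g\in C_c(X)$, where $\bar{\cdot}$ is the involution of $(D,*)$. The CAS is called compact if $X$ and $D$ are compact. Statement. Let $(X,D,K)$ and $(X,D,\tilde K)$ be compact CAS with the same spaces $X,D$ and the same map $\pi$, and let $(D,*)$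 and $(D,\tilde *)$ be associated hypergroup structures. Then $K=\tilde K$, and $(D,*)=(D,\tilde *)$, i.e. the convolutions on $M_b(D)$, the identities and the involutions coincide. -/

import Mathlib

open MeasureTheory TopologicalSpace
open scoped CompactlySupported BoundedContinuousFunction

noncomputable section

/-- A finite positive measure, regarded as a complex measure. -/
def MeasureTheory.FiniteMeasure.toComplex {D : Type*} [MeasurableSpace D] (μ : FiniteMeasure D) :
    ComplexMeasure D :=
  (μ : Measure D).toSignedMeasure.toComplexMeasure 0

/-- A hypergroup structure in the sense of Dunkl, Jewett and Spector on a second countable locally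
compact Hausdorff space `D`. On such a space every complex Borel measure is bounded and regular, so
that `M_b(D)` is `ComplexMeasure D`. -/
@[ext]
structure Hypergroup (D : Type*) [TopologicalSpace D] [T2Space D] [LocallyCompactSpace D]
    [SecondCountableTopology D] [MeasurableSpace D] [BorelSpace D] where
  /-- The bilinear convolution on `M_b(D)`. -/
  conv : ComplexMeasure D →ₗ[ℂ] ComplexMeasure D →ₗ[ℂ] ComplexMeasure D
  /-- The probability measure `δ_x * δ_y` (determined by `conv` through `conv_dirac`). -/
  diracConv : D → D → ProbabilityMeasure D
  /-- The neutral element. -/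
  e : D
  /-- The involution. -/
  bar : D → D
  conv_assoc : ∀ μ ν ρ, conv (conv μ ν) ρ = conv μ (conv ν ρ)
  /-- Weak continuity: the convolution maps pairs of positive measures to positive measures, and is
  jointly continuous there for the weak topology (tested against bounded continuous functions). -/
  conv_weakly_continuous : ∃ c : FiniteMeasure D × FiniteMeasure D → FiniteMeasure D,
    Continuous c ∧ ∀ μ ν, (c (μ, ν)).toComplex = conv μ.toComplex ν.toComplex
  conv_dirac : ∀ x y,
    conv (diracProba x).toFiniteMeasure.toComplex (diracProba y).toFiniteMeasure.toComplex =
      (diracConv x y).toFiniteMeasure.toComplex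
  /-- The support of `δ_x * δ_y` is compact and depends continuously on `(x, y)`. The topology on
  the nonempty compact sets is the Vietoris topology, which is the Michael topology. -/
  support_continuous : ∃ S : D × D → NonemptyCompacts D, Continuous S ∧
    ∀ x y, (S (x, y) : Set D) = (diracConv x y : Measure D).support
  diracConv_e : ∀ x, diracConv x e = diracProba x
  e_diracConv : ∀ x, diracConv e x = diracProba x
  bar_continuous : Continuous bar
  bar_bar : ∀ x, bar (bar x) = x
  e_mem_support_iff : ∀ x y, e ∈ (diracConv x y : Measure D).support ↔ y = bar x
  map_bar_diracConv : ∀ x y,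
    (diracConv x y : Measure D).map bar = (diracConv (bar y) (bar x) : Measure D)

/-- `IsContinuousAssociationScheme K H π` says that `(X, D, K)` is a continuous association scheme
(CAS), where `K` is a kernel from `X × D` to `X`, `H` is the associated hypergroup structure on `D`,
and `π : X × X → D` is the associated projection. -/
structure IsContinuousAssociationScheme {X D : Type*}
    [TopologicalSpace X] [T2Space X] [LocallyCompactSpace X] [SecondCountableTopology X]
    [MeasurableSpace X] [BorelSpace X]
    [TopologicalSpace D] [T2Space D] [LocallyCompactSpace D] [SecondCountableTopology D]
    [MeasurableSpace D] [BorelSpace D]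
    (K : ProbabilityTheory.Kernel (X × D) X) (H : Hypergroup D) (π : X × X → D) : Prop where
  isMarkovKernel : ProbabilityTheory.IsMarkovKernel K
  /-- `K` is a continuous kernel: `T_K` maps `C_b(X)` to `C_b(X × D)`. -/
  continuous_kernel : ∀ f : X →ᵇ ℂ, Continuous fun p : X × D => ∫ y, f y ∂(K p)
  /-- The supports are compact and depend continuously on `(x, h)`; on the nonempty compact subsets
  of a metrizable space the Vietoris topology is the topology of the Hausdorff metric. -/
  support_continuous : ∃ S : X × D → NonemptyCompacts X, Continuous S ∧
    ∀ p, (S p : Set X) = (K p).support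
  /-- For each `x`, the supports of the measures `K(x, h; ·)`, `h ∈ D`, form a partition of `X`, and
  `π (x, y)` is the index of the member containing `y`. -/
  mem_support_iff : ∀ x y h, y ∈ (K (x, h)).support ↔ h = π (x, y)
  continuous_proj : Continuous π
  /-- `K_{h₁} ∘ K_{h₂} = ∫ K_h d(δ_{h₁} * δ_{h₂})(h)`. -/
  kernel_comp : ∀ (h₁ h₂ : D) (x : X) (A : Set X), MeasurableSet A →
    ∫⁻ y, K (y, h₂) A ∂(K (x, h₁)) = ∫⁻ h, K (x, h) A ∂(H.diracConv h₁ h₂ : Measure D)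
  kernel_e : ∀ x, K (x, H.e) = Measure.dirac x
  /-- There is a positive Radon measure on `X` with full support for which `T_{bar h}` is the
  adjoint of `T_h`. -/
  exists_adjoint_measure : ∃ ω : Measure X, ω.Regular ∧ ω.support = Set.univ ∧
    ∀ (h : D) (f g : C_c(X, ℂ)),
      ∫ x, (∫ y, f y ∂(K (x, H.bar h))) * g x ∂ω = ∫ x, f x * (∫ y, g y ∂(K (x, h))) ∂ω

end

noncomputable section

open ProbabilityTheory

/-! The measure `K (x, d)` lives on the fibre `π (x, ·) = d`, so it is the disintegration along `π
(x, ·)` of any normalized adjoint measure `ω`. It therefore suffices to show that `ω` disintegrates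
in this way and that `ω` depends only on `π`.

The key is `integral_eq_of_forall_integral_kernel_eq`: the numbers `T_d f x`, `d ∈ D`, determine `∫
f dω`. Indeed some average `T_ν` over `D` makes `f` constant, with value `∫ f dω` because every
`T_d` preserves `ω`. Such a `ν` comes from minimizing a supremum over the compact space of
probability measures on `D` and applying a maximum principle (`exists_transition_eq_const`). Hence
the disintegration follows, and the image of `ω` under `π (x, ·)` is independent of `x`. Together
with `proj_symm` this makes `ω` uniformly distributed with respect to `π`, and a Fubini argument
shows that two such measures agree (`adjointMeasure_unique`).

Finally `K` and `π` give the convolutions of Dirac measures (`diracConv_apply`), and weak continuity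
and bilinearity extend them to `M_b(D)`. -/

theorem MeasureTheory.Measure.integral_bind_kernel {α β : Type*} [MeasurableSpace α]
    [MeasurableSpace β] (μ : Measure α) [SFinite μ] (κ : Kernel α β) [IsSFiniteKernel κ] {f : β → ℝ}
    (hf : Integrable f (μ.bind κ)) : ∫ y, f y ∂(μ.bind κ) = ∫ x, ∫ y, f y ∂(κ x) ∂μ := by
  have h := Kernel.integral_comp (η := κ) (κ := Kernel.const Unit μ) (a := ()) (f := f)
  simp only [Kernel.comp_apply, Kernel.const_apply] at h
  exact h hf

/-! ### Averages of the kernel over `D`, and convolution of measures on `D`. -/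

namespace IsContinuousAssociationScheme

section

variable {X D : Type*} [MeasurableSpace X] [MeasurableSpace D]

/-- The kernel `K` with the element of `X` fixed. -/
def kernelAt (K : Kernel (X × D) X) (x : X) : Kernel D X :=
  K.comap (fun d => (x, d)) (by fun_prop)

@[simp]
theorem kernelAt_apply (K : Kernel (X × D) X) (x : X) (d : D) : kernelAt K x d = K (x, d) := rfl

/-- The kernel `∫ K_d dν(d)` on `X`. -/
def mixture (K : Kernel (X × D) X) (ν : Measure D) [SFinite ν] : Kernel X X :=
  K ∘ₖ (Kernel.id ×ₖ Kernel.const X ν)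

theorem mixture_apply (K : Kernel (X × D) X) (ν : Measure D) [SFinite ν] (x : X) :
    mixture K ν x = ν.bind (kernelAt K x) := by
  ext s hs
  rw [mixture, Kernel.comp_apply' _ _ _ hs, Kernel.lintegral_id_prod,
    Measure.bind_apply hs (Kernel.aemeasurable _)]
  · simp
  · exact K.measurable_coe hs

end

variable {X D : Type*}
    [TopologicalSpace X] [T2Space X] [CompactSpace X] [SecondCountableTopology X]
    [MeasurableSpace X] [BorelSpace X]
    [TopologicalSpace D] [T2Space D] [CompactSpace D] [SecondCountableTopology D]
    [MeasurableSpace D] [BorelSpace D]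
    {K : Kernel (X × D) X} {H : Hypergroup D} {π : X × X → D}

theorem ae_proj_eq (hK : IsContinuousAssociationScheme K H π) (x : X) (d : D) :
    ∀ᵐ y ∂(K (x, d)), π (x, y) = d := by
  filter_upwards [Measure.support_mem_ae (μ := K (x, d))] with y hy
  exact ((hK.mem_support_iff x y d).1 hy).symm

theorem continuous_proj_right (hK : IsContinuousAssociationScheme K H π) (x : X) :
    Continuous fun y => π (x, y) :=
  hK.continuous_proj.comp (by fun_prop)

theorem proj_surjective (hK : IsContinuousAssociationScheme K H π) (x : X) :
    Function.Surjective fun y => π (x, y) := by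
  intro d
  have := hK.isMarkovKernel
  obtain ⟨y, hy⟩ := Measure.nonempty_support (μ := K (x, d)) (NeZero.ne _)
  exact ⟨y, ((hK.mem_support_iff x y d).1 hy).symm⟩

theorem proj_self (hK : IsContinuousAssociationScheme K H π) (x : X) : π (x, x) = H.e := by
  have h := hK.ae_proj_eq x H.e
  rw [hK.kernel_e] at h
  simpa [ae_dirac_iff, ae_dirac_eq] using h

theorem kernel_apply_preimage (hK : IsContinuousAssociationScheme K H π) (x : X) (d : D)
    (B : Set D) : K (x, d) ((fun y => π (x, y)) ⁻¹' B) = B.indicator 1 d := by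
  have := hK.isMarkovKernel
  by_cases hd : d ∈ B
  · have h : (fun y => π (x, y)) ⁻¹' B =ᵐ[K (x, d)] Set.univ :=
      Filter.eventuallyEq_univ.2 <| (hK.ae_proj_eq x d).mono fun y hy => by
        change π (x, y) ∈ B
        rwa [hy]
    simp [measure_congr h, hd]
  · rw [Set.indicator_of_notMem hd]
    refine measure_mono_null ?_ (ae_iff.1 (hK.ae_proj_eq x d))
    rintro y hy rfl
    exact hd hy

/-- Put `A = π (x, ·) ⁻¹' B` in `kernel_comp`: since `K (x, h)` is carried by the fibre over `h`,
the integrand on the right is the indicator of `B`. The convolution is thus recovered from `K` and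
`π`. -/
theorem diracConv_apply (hK : IsContinuousAssociationScheme K H π) (x : X) (h₁ h₂ : D)
    {B : Set D} (hB : MeasurableSet B) :
    (H.diracConv h₁ h₂ : Measure D) B =
      ∫⁻ y, K (y, h₂) ((fun y => π (x, y)) ⁻¹' B) ∂(K (x, h₁)) := by
  rw [hK.kernel_comp h₁ h₂ x _ ((hK.continuous_proj_right x).measurable hB)]
  simp_rw [hK.kernel_apply_preimage]
  rw [lintegral_indicator_one hB]

theorem measurable_diracConv [Nonempty X] (hK : IsContinuousAssociationScheme K H π) :
    Measurable fun p : D × D => (H.diracConv p.1 p.2 : Measure D) := by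
  have := hK.isMarkovKernel
  obtain ⟨x⟩ := ‹Nonempty X›
  refine Measure.measurable_of_measurable_coe _ fun B hB => ?_
  simp_rw [hK.diracConv_apply x _ _ hB]
  have hm := (hK.continuous_proj_right x).measurable hB
  let κ : Kernel (D × D) X := K.comap (fun p => (x, p.1)) (by fun_prop)
  have hg : Measurable fun q : (D × D) × X => K (q.2, q.1.2) ((fun y => π (x, y)) ⁻¹' B) :=
    (K.measurable_coe hm).comp (by fun_prop)
  exact hg.lintegral_kernel_prod_right' (κ := κ)

/-- The convolution of two measures on `D`. -/
def mixConv (H : Hypergroup D) (ν ν' : Measure D) : Measure D :=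
  (ν.prod ν').bind fun p => (H.diracConv p.1 p.2 : Measure D)

theorem isProbabilityMeasure_mixConv [Nonempty X] (hK : IsContinuousAssociationScheme K H π)
    (ν ν' : Measure D) [IsProbabilityMeasure ν] [IsProbabilityMeasure ν'] :
    IsProbabilityMeasure (mixConv H ν ν') := by
  constructor
  rw [mixConv, Measure.bind_apply .univ hK.measurable_diracConv.aemeasurable]
  simp

/-- This is `kernel_comp` integrated over `ν × ν'`, with Tonelli exchanging the point of `X` and the
second index. -/
theorem mixConv_bind [Nonempty X] (hK : IsContinuousAssociationScheme K H π)
    (ν ν' : Measure D) [IsProbabilityMeasure ν] [IsProbabilityMeasure ν'] (x : X) :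
    (mixConv H ν ν').bind (kernelAt K x) = (mixture K ν x).bind (mixture K ν') := by
  have := hK.isMarkovKernel
  ext s hs
  have hKs := K.measurable_coe hs
  rw [Measure.bind_apply hs (Kernel.aemeasurable _), mixConv,
    Measure.lintegral_bind hK.measurable_diracConv.aemeasurable
      (Kernel.measurable_coe _ hs).aemeasurable,
    Measure.bind_apply hs (Kernel.aemeasurable _), mixture_apply K ν,
    Measure.lintegral_bind (Kernel.aemeasurable _) (Kernel.measurable_coe _ hs).aemeasurable]
  simp_rw [mixture_apply, Measure.bind_apply hs (Kernel.aemeasurable _), kernelAt_apply,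
    ← hK.kernel_comp _ _ x s hs]
  let κ : Kernel (D × D) X := K.comap (fun p => (x, p.1)) (by fun_prop)
  have hg : Measurable fun q : (D × D) × X => K (q.2, q.1.2) s := hKs.comp (by fun_prop)
  have hm := hg.lintegral_kernel_prod_right' (κ := κ)
  simp only [κ, Kernel.comap_apply] at hm
  rw [lintegral_prod _ hm.aemeasurable]
  refine lintegral_congr fun d => ?_
  rw [lintegral_lintegral_swap]
  exact hKs.aemeasurable

theorem continuous_integral_kernel (hK : IsContinuousAssociationScheme K H π) (f : C(X, ℝ)) :
    Continuous fun p : X × D => ∫ y, f y ∂(K p) := by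
  have h := Complex.continuous_re.comp (hK.continuous_kernel
    (BoundedContinuousFunction.mkOfCompact ⟨fun x => (f x : ℂ), by fun_prop⟩))
  simpa [Function.comp_def, integral_complex_ofReal] using h

/-- The operator `T_ν = ∫ T_d dν(d)` on real continuous functions. -/
def transition (hK : IsContinuousAssociationScheme K H π) (ν : Measure D) [IsFiniteMeasure ν]
    (f : C(X, ℝ)) : C(X, ℝ) where
  toFun x := ∫ d, ∫ y, f y ∂(K (x, d)) ∂ν
  continuous_toFun := by
    have := continuous_parametric_integral_of_continuous (μ := ν)
      (f := fun x d => ∫ y, f y ∂(K (x, d))) (hK.continuous_integral_kernel f)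
      (isCompact_univ (X := D))
    simpa using this

theorem transition_apply (hK : IsContinuousAssociationScheme K H π) (ν : Measure D)
    [IsFiniteMeasure ν] (f : C(X, ℝ)) (x : X) :
    hK.transition ν f x = ∫ d, ∫ y, f y ∂(K (x, d)) ∂ν := rfl

theorem transition_eq_integral_mixture (hK : IsContinuousAssociationScheme K H π) (ν : Measure D)
    [IsProbabilityMeasure ν] (f : C(X, ℝ)) (x : X) :
    hK.transition ν f x = ∫ y, f y ∂(mixture K ν x) := by
  have := hK.isMarkovKernel
  have : IsMarkovKernel (kernelAt K x) := by unfold kernelAt; infer_instance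
  rw [mixture_apply, Measure.integral_bind_kernel]
  · rfl
  · exact f.continuous.integrable_of_hasCompactSupport (.of_compactSpace _)

theorem transition_mixConv [Nonempty X] (hK : IsContinuousAssociationScheme K H π)
    (ν ν' : Measure D) [IsProbabilityMeasure ν] [IsProbabilityMeasure ν']
    [IsProbabilityMeasure (mixConv H ν ν')] (f : C(X, ℝ)) :
    hK.transition (mixConv H ν ν') f = hK.transition ν (hK.transition ν' f) := by
  have := hK.isMarkovKernel
  have : IsMarkovKernel (mixture K ν) := by unfold mixture; infer_instance
  have : IsMarkovKernel (mixture K ν') := by unfold mixture; infer_instance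
  ext x
  rw [transition_eq_integral_mixture, transition_eq_integral_mixture, mixture_apply,
    hK.mixConv_bind, Measure.integral_bind_kernel]
  · simp_rw [transition_eq_integral_mixture]
  · exact f.continuous.integrable_of_hasCompactSupport (.of_compactSpace _)

end IsContinuousAssociationScheme

/-! ### Continuous functions, supports and bump functions. -/

theorem ContinuousMap.integrable_of_compactSpace {X : Type*} [TopologicalSpace X] [CompactSpace X]
    [SecondCountableTopology X] [MeasurableSpace X] [OpensMeasurableSpace X] {μ : Measure X}
    [IsFiniteMeasure μ] (f : C(X, ℝ)) : Integrable f μ :=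
  f.continuous.integrable_of_hasCompactSupport (.of_compactSpace _)

theorem ContinuousMap.eq_zero_of_integral_eq_zero {X : Type*} [TopologicalSpace X] [CompactSpace X]
    [SecondCountableTopology X] [MeasurableSpace X] [OpensMeasurableSpace X] {μ : Measure X}
    [IsFiniteMeasure μ] {f : C(X, ℝ)} (hf : ∀ x, 0 ≤ f x) (h : ∫ x, f x ∂μ = 0) {x : X}
    (hx : x ∈ μ.support) : f x = 0 := by
  by_contra hne
  have h0 := (integral_eq_zero_iff_of_nonneg hf f.integrable_of_compactSpace).1 h
  have hU : {y | f y ≠ 0} ∈ nhds x := (isOpen_ne_fun f.continuous continuous_const).mem_nhds hne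
  exact ((Measure.mem_support_iff_forall x).1 hx _ hU).ne' (ae_iff.1 h0)

theorem IsOpen.exists_continuousMap_bump {X : Type*} [TopologicalSpace X] [NormalSpace X]
    [T1Space X] {U : Set X} (hU : IsOpen U) {x : X} (hx : x ∈ U) :
    ∃ f : C(X, ℝ), f x = 1 ∧ (∀ y ∉ U, f y = 0) ∧ ∀ y, 0 ≤ f y := by
  obtain ⟨f, hf₀, hf₁, hf⟩ := exists_continuous_zero_one_of_isClosed hU.isClosed_compl
    (isClosed_singleton (x := x)) (by simpa using hx)
  exact ⟨f, hf₁ rfl, fun y hy => hf₀ hy, fun y => (hf y).1⟩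

/-- A probability measure with full support such that `T_{bar d}` is the adjoint of `T_d`. -/
structure IsAdjointMeasure {X D : Type*} [TopologicalSpace X] [MeasurableSpace X]
    [TopologicalSpace D] [T2Space D] [LocallyCompactSpace D] [SecondCountableTopology D]
    [MeasurableSpace D] [BorelSpace D] (K : Kernel (X × D) X) (H : Hypergroup D) (ω : Measure X) :
    Prop where
  isProbabilityMeasure : IsProbabilityMeasure ω
  support_eq : ω.support = Set.univ
  adjoint : ∀ (d : D) (f g : C(X, ℝ)),
    ∫ x, (∫ y, f y ∂(K (x, H.bar d))) * g x ∂ω = ∫ x, f x * (∫ y, g y ∂(K (x, d))) ∂ω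

/-! ### Adjoint measures: symmetry of `π`, constant averages, disintegration. -/

namespace IsContinuousAssociationScheme

variable {X D : Type*}
    [TopologicalSpace X] [T2Space X] [CompactSpace X] [SecondCountableTopology X]
    [MeasurableSpace X] [BorelSpace X]
    [TopologicalSpace D] [T2Space D] [CompactSpace D] [SecondCountableTopology D]
    [MeasurableSpace D] [BorelSpace D]
    {K : Kernel (X × D) X} {H : Hypergroup D} {π : X × X → D} {ω : Measure X}

theorem exists_isAdjointMeasure [Nonempty X] (hK : IsContinuousAssociationScheme K H π) :
    ∃ ω : Measure X, IsAdjointMeasure K H ω := by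
  obtain ⟨ω, hreg, hsupp, hadj⟩ := hK.exists_adjoint_measure
  have hω : ω ≠ 0 := by
    rintro rfl
    exact Set.empty_ne_univ (by simpa using hsupp)
  have : NeZero ω := ⟨hω⟩
  refine ⟨(ω Set.univ)⁻¹ • ω, ⟨inferInstance, ?_, fun d f g => ?_⟩⟩
  · refine Set.univ_subset_iff.1 (hsupp ▸ Measure.AbsolutelyContinuous.support_mono ?_)
    exact Measure.absolutelyContinuous_smul (ENNReal.inv_ne_zero.2 (measure_ne_top _ _))
  · let toC (f : C(X, ℝ)) : C_c(X, ℂ) := ⟨⟨fun x => (f x : ℂ), by fun_prop⟩, .of_compactSpace _⟩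
    have h := hadj d (toC f) (toC g)
    simp only [integral_smul_measure]
    congr 1
    have hc : ∀ (f : C(X, ℝ)) x, toC f x = (f x : ℂ) := fun _ _ => rfl
    simp only [hc, integral_complex_ofReal] at h
    exact_mod_cast h

/-- Adjointness tested on bumps `f` at `x` and `g` at `y`: if the fibres over `bar d` avoided a
neighbourhood of `(y, x)`, then `∫ f · T_d g dω` would vanish. Full support of `ω` then gives `T_d g
x = 0`, although `y` lies in the support of `K (x, d)`. -/
theorem proj_symm [Nonempty X] (hK : IsContinuousAssociationScheme K H π) (x y : X) :
    π (y, x) = H.bar (π (x, y)) := by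
  obtain ⟨ω, hω⟩ := hK.exists_isAdjointMeasure
  have := hω.isProbabilityMeasure
  have := hK.isMarkovKernel
  by_contra hne
  set d := π (x, y) with hd
  have hopen : IsOpen {p : X × X | π p ≠ H.bar d} :=
    isOpen_ne_fun hK.continuous_proj continuous_const
  obtain ⟨V, U, hV, hU, hyV, hxU, hVU⟩ := isOpen_prod_iff.1 hopen y x hne
  obtain ⟨f, hfx, hfU, hf⟩ := hU.exists_continuousMap_bump hxU
  obtain ⟨g, hgy, hgV, hg⟩ := hV.exists_continuousMap_bump hyV
  have hleft : ∀ z, (∫ w, f w ∂(K (z, H.bar d))) * g z = 0 := by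
    intro z
    by_cases hz : z ∈ V
    · refine mul_eq_zero_of_left (integral_eq_zero_of_ae ?_) _
      filter_upwards [hK.ae_proj_eq z (H.bar d)] with w hw
      exact hfU w fun hwU => hVU (Set.mk_mem_prod hz hwU) hw
    · simp [hgV z hz]
  have hadj := hω.adjoint d f g
  simp only [hleft, integral_zero] at hadj
  have hc : Continuous fun z => ∫ w, g w ∂(K (z, d)) :=
    (hK.continuous_integral_kernel g).comp (by fun_prop)
  have h₁ := ContinuousMap.eq_zero_of_integral_eq_zero (μ := ω) (x := x)
    (f := ⟨fun z => f z * ∫ w, g w ∂(K (z, d)), by fun_prop⟩)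
    (fun z => mul_nonneg (hf z) (integral_nonneg hg)) hadj.symm (by simp [hω.support_eq])
  simp only [ContinuousMap.coe_mk, hfx, one_mul] at h₁
  have h₂ := ContinuousMap.eq_zero_of_integral_eq_zero hg h₁ ((hK.mem_support_iff x y d).2 hd)
  simp [hgy] at h₂

/-- Every `T_d` preserves the integral with respect to an adjoint measure. -/
theorem integral_integral_kernel (hK : IsContinuousAssociationScheme K H π)
    (hω : IsAdjointMeasure K H ω) (d : D) (f : C(X, ℝ)) :
    ∫ x, ∫ y, f y ∂(K (x, d)) ∂ω = ∫ x, f x ∂ω := by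
  have := hK.isMarkovKernel
  -- Adjointness against the constant `1`, which every `T` fixes.
  have h := hω.adjoint (H.bar d) f 1
  rw [H.bar_bar] at h
  simpa using h

theorem integral_transition (hK : IsContinuousAssociationScheme K H π)
    (hω : IsAdjointMeasure K H ω) (ν : Measure D) [IsProbabilityMeasure ν] (f : C(X, ℝ)) :
    ∫ x, hK.transition ν f x ∂ω = ∫ x, f x ∂ω := by
  have := hω.isProbabilityMeasure
  simp_rw [transition_apply]
  rw [integral_integral_swap]
  · simp [hK.integral_integral_kernel hω]
  · exact ContinuousMap.integrable_of_compactSpace ⟨_, hK.continuous_integral_kernel f⟩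

theorem integral_kernel_le (hK : IsContinuousAssociationScheme K H π) {f : C(X, ℝ)} {c : ℝ}
    (hf : ∀ x, f x ≤ c) (x : X) (d : D) : ∫ y, f y ∂(K (x, d)) ≤ c := by
  have := hK.isMarkovKernel
  simpa using integral_mono f.integrable_of_compactSpace (integrable_const c)
    (μ := K (x, d)) hf

theorem transition_le (hK : IsContinuousAssociationScheme K H π) (ν : Measure D)
    [IsProbabilityMeasure ν] {f : C(X, ℝ)} {c : ℝ} (hf : ∀ x, f x ≤ c) (x : X) :
    hK.transition ν f x ≤ c := by
  have hc : Continuous fun d => ∫ y, f y ∂(K (x, d)) :=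
    (hK.continuous_integral_kernel f).comp (by fun_prop)
  simpa [transition_apply] using integral_mono (μ := ν)
    (ContinuousMap.integrable_of_compactSpace ⟨_, hc⟩) (integrable_const c)
    (hK.integral_kernel_le hf x)

/-- The maximum principle for `T_ν`, where `ν` has full support. -/
theorem eq_of_transition_eq (hK : IsContinuousAssociationScheme K H π) (ν : Measure D)
    [IsProbabilityMeasure ν] (hν : ν.support = Set.univ) {f : C(X, ℝ)} {c : ℝ}
    (hf : ∀ x, f x ≤ c) {x : X} (hx : hK.transition ν f x = c) (y : X) : f y = c := by
  have := hK.isMarkovKernel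
  have hc : Continuous fun d => ∫ y, f y ∂(K (x, d)) :=
    (hK.continuous_integral_kernel f).comp (by fun_prop)
  have hint : Integrable (fun d => ∫ y, f y ∂(K (x, d))) ν :=
    ContinuousMap.integrable_of_compactSpace ⟨_, hc⟩
  -- A nonnegative gap with zero `ν`-integral vanishes on all of `D`. The same argument inside `K
  -- (x, π (x, y))` reaches `y`, since the supports cover `X`.
  let g : C(D, ℝ) := ⟨fun d => c - ∫ y, f y ∂(K (x, d)), by fun_prop⟩
  have hg : ∫ y, f y ∂(K (x, π (x, y))) = c := by
    have := ContinuousMap.eq_zero_of_integral_eq_zero (μ := ν) (f := g) (x := π (x, y))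
      (fun d => sub_nonneg.2 (hK.integral_kernel_le hf x d))
      (by
        change ∫ d, (c - ∫ y, f y ∂(K (x, d))) ∂ν = 0
        rw [integral_sub (integrable_const c) hint]
        simp [← hx, transition_apply]) (by simp [hν])
    exact (sub_eq_zero.1 this).symm
  have := ContinuousMap.eq_zero_of_integral_eq_zero (μ := K (x, π (x, y)))
    (f := ⟨fun y => c - f y, by fun_prop⟩) (x := y)
    (fun y => sub_nonneg.2 (hf y))
    (by
      change ∫ z, (c - f z) ∂(K (x, π (x, y))) = 0
      rw [integral_sub (integrable_const c) f.integrable_of_compactSpace]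
      simp [hg]) ((hK.mem_support_iff _ _ _).2 rfl)
  exact (sub_eq_zero.1 this).symm

theorem support_map_proj (hK : IsContinuousAssociationScheme K H π)
    (hω : IsAdjointMeasure K H ω) (x : X) :
    (ω.map fun y => π (x, y)).support = Set.univ := by
  refine Set.eq_univ_of_forall fun d => ?_
  obtain ⟨y, hy⟩ := hK.proj_surjective x d
  rw [(nhds_basis_opens d).mem_measureSupport]
  rintro U ⟨hdU, hU⟩
  have hc := hK.continuous_proj_right x
  rw [Measure.map_apply hc.measurable hU.measurableSet]
  have hyω : y ∈ ω.support := by simp [hω.support_eq]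
  exact (Measure.mem_support_iff_forall y).1 hyω _
    (hc.continuousAt.preimage_mem_nhds (hU.mem_nhds (by simpa [hy] using hdU)))

/-- Two continuous functions admit a common `T_ν` that makes both of them constant. -/
theorem exists_transition_eq_const [Nonempty X] (hK : IsContinuousAssociationScheme K H π)
    (hω : IsAdjointMeasure K H ω) (f g : C(X, ℝ)) :
    ∃ ν : ProbabilityMeasure D, (∀ x, hK.transition (ν : Measure D) f x = ∫ y, f y ∂ω) ∧
      ∀ x, hK.transition (ν : Measure D) g x = ∫ y, g y ∂ω := by
  have := hω.isProbabilityMeasure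
  obtain ⟨x₀⟩ := ‹Nonempty X›
  let m (f : C(X, ℝ)) (ν : ProbabilityMeasure D) : ℝ := ⨆ x, hK.transition (ν : Measure D) f x
  have hbdd (f : C(X, ℝ)) (ν : ProbabilityMeasure D) :
      BddAbove (Set.range (hK.transition (ν : Measure D) f)) :=
    (isCompact_range (map_continuous _)).bddAbove
  have hm (f : C(X, ℝ)) : LowerSemicontinuous (m f) := by
    refine lowerSemicontinuous_ciSup (hbdd f) fun x => Continuous.lowerSemicontinuous ?_
    exact ProbabilityMeasure.continuous_integral_continuousMap
      (⟨_, (hK.continuous_integral_kernel f).comp (by fun_prop : Continuous fun d => (x, d))⟩ :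
        C(D, ℝ))
  have : Nonempty (ProbabilityMeasure D) := ⟨diracProba H.e⟩
  -- Minimizing the sum of the two suprema lets a single `ν` serve both functions.
  obtain ⟨ν, -, hν⟩ := ((hm f).add (hm g)).lowerSemicontinuousOn (s := Set.univ)
    |>.exists_isMinOn Set.univ_nonempty isCompact_univ
  -- This image is used only as a probability measure of full support. Convolving `ν` with it on the
  -- left raises neither supremum, so minimality of the sum forces both to stay the same.
  have hprob : IsProbabilityMeasure (ω.map fun y => π (x₀, y)) :=
    Measure.isProbabilityMeasure_map (hK.continuous_proj_right x₀).measurable.aemeasurable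
  have hconv := hK.isProbabilityMeasure_mixConv (ω.map fun y => π (x₀, y)) (ν : Measure D)
  have hmin : m f ν + m g ν ≤ m f ⟨_, hconv⟩ + m g ⟨_, hconv⟩ := hν (Set.mem_univ _)
  have hle (f : C(X, ℝ)) : m f ⟨_, hconv⟩ ≤ m f ν := by
    refine ciSup_le fun x => ?_
    change hK.transition (mixConv H _ _) f x ≤ _
    rw [transition_mixConv]
    exact hK.transition_le _ (fun y => le_ciSup (hbdd f ν) y) x
  have hconst (f : C(X, ℝ)) (h : m f ⟨_, hconv⟩ = m f ν) (x : X) :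
      hK.transition (ν : Measure D) f x = ∫ y, f y ∂ω := by
    -- At a maximum point of the further averaged function, the average of `T_ν f` equals its
    -- supremum, so the maximum principle applies to `T_ν f`.
    obtain ⟨x₁, hx₁⟩ := (isCompact_range (map_continuous
      (hK.transition (mixConv H (ω.map fun y => π (x₀, y)) (ν : Measure D)) f))).sSup_mem
      (Set.range_nonempty_iff_nonempty.2 ⟨x₀⟩)
    have key : ∀ y, hK.transition (ν : Measure D) f y = m f ν := by
      refine hK.eq_of_transition_eq _ (hK.support_map_proj hω x₀) (x := x₁)
        (fun y => le_ciSup (hbdd f ν) y) ?_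
      rw [← transition_mixConv, ← h]
      exact hx₁
    rw [← hK.integral_transition hω (ν : Measure D) f]
    simp [key]
  exact ⟨ν, hconst f (by linarith [hle f, hle g]), hconst g (by linarith [hle f, hle g])⟩

/-- If `T_d f x = T_d g x'` for all `d`, then `f` and `g` have the same integral. -/
theorem integral_eq_of_forall_integral_kernel_eq [Nonempty X]
    (hK : IsContinuousAssociationScheme K H π) (hω : IsAdjointMeasure K H ω) {f g : C(X, ℝ)}
    {x x' : X} (h : ∀ d, ∫ y, f y ∂(K (x, d)) = ∫ y, g y ∂(K (x', d))) :
    ∫ y, f y ∂ω = ∫ y, g y ∂ω := by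
  obtain ⟨ν, hf, hg⟩ := hK.exists_transition_eq_const hω f g
  rw [← hf x, ← hg x']
  simp [transition_apply, h]

/-- The image of `ω` under `π (x, ·)` does not depend on `x`. -/
theorem integral_comp_proj_eq [Nonempty X] (hK : IsContinuousAssociationScheme K H π)
    (hω : IsAdjointMeasure K H ω) (φ : C(D, ℝ)) (x x' : X) :
    ∫ y, φ (π (x, y)) ∂ω = ∫ y, φ (π (x', y)) ∂ω := by
  have := hK.isMarkovKernel
  have hφ (x : X) (d : D) : ∫ y, φ (π (x, y)) ∂(K (x, d)) = φ d := by
    rw [integral_congr_ae ((hK.ae_proj_eq x d).mono fun y hy => by rw [hy])]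
    simp
  exact hK.integral_eq_of_forall_integral_kernel_eq hω
    (f := φ.comp ⟨_, hK.continuous_proj_right x⟩) (g := φ.comp ⟨_, hK.continuous_proj_right x'⟩)
    fun d => by simpa using (hφ x d).trans (hφ x' d).symm

/-- The disintegration of `ω` along `π (x, ·)` by the measures `K (x, d)`. -/
theorem integral_comp_proj_mul [Nonempty X] (hK : IsContinuousAssociationScheme K H π)
    (hω : IsAdjointMeasure K H ω) (φ : C(D, ℝ)) (f : C(X, ℝ)) (x : X) :
    ∫ y, φ (π (x, y)) * f y ∂ω = ∫ y, φ (π (x, y)) * ∫ z, f z ∂(K (x, π (x, y))) ∂ω := by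
  have := hK.isMarkovKernel
  have hπ := hK.continuous_proj_right x
  have hc : Continuous fun y => ∫ z, f z ∂(K (x, π (x, y))) :=
    (hK.continuous_integral_kernel f).comp (continuous_const.prodMk hπ)
  have hφ : Continuous fun y => φ (π (x, y)) := φ.continuous.comp hπ
  refine hK.integral_eq_of_forall_integral_kernel_eq hω (x := x) (x' := x)
    (f := ⟨fun y => φ (π (x, y)) * f y, hφ.mul f.continuous⟩)
    (g := ⟨fun y => φ (π (x, y)) * ∫ z, f z ∂(K (x, π (x, y))), hφ.mul hc⟩) fun d => ?_
  -- On the fibre over `d` both functions average to `φ d * T_d f x`.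
  have h₁ : ∫ y, φ (π (x, y)) * f y ∂(K (x, d)) = ∫ y, φ d * f y ∂(K (x, d)) :=
    integral_congr_ae ((hK.ae_proj_eq x d).mono fun y hy => by simp [hy])
  have h₂ : ∫ y, φ (π (x, y)) * ∫ z, f z ∂(K (x, π (x, y))) ∂(K (x, d)) =
      ∫ y, φ d * ∫ z, f z ∂(K (x, d)) ∂(K (x, d)) :=
    integral_congr_ae ((hK.ae_proj_eq x d).mono fun y hy => by simp [hy])
  simp only [ContinuousMap.coe_mk]
  rw [h₁, h₂, integral_const_mul]
  simp

end IsContinuousAssociationScheme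

/-! ### Weak approximation by discrete measures, and extension of the convolution from Dirac
measures. -/

namespace MeasureTheory.FiniteMeasure

/-- A weakly closed property of finite measures which is stable under sums and holds for the
multiples of Dirac measures holds for all finite measures. -/
theorem induction_of_dirac {D : Type*} [TopologicalSpace D] [PseudoMetrizableSpace D]
    [SecondCountableTopology D] [MeasurableSpace D] [BorelSpace D]
    {p : FiniteMeasure D → Prop} (hp : IsClosed {μ | p μ}) (zero : p 0)
    (add : ∀ μ ν, p μ → p ν → p (μ + ν))
    (smul_dirac : ∀ (c : NNReal) (x : D), p (c • (diracProba x).toFiniteMeasure))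
    (μ : FiniteMeasure D) : p μ := by
  let _ := pseudoMetrizableSpacePseudoMetric D
  rcases isEmpty_or_nonempty D with hD | ⟨⟨x₀⟩⟩
  · convert zero
    exact FiniteMeasure.toMeasure_injective (Measure.eq_zero_of_isEmpty _)
  have hsimple (s : SimpleFunc D D) : p (μ.map s) := by
    have : μ.map s = ∑ y ∈ s.range, μ (s ⁻¹' {y}) • (diracProba y).toFiniteMeasure := by
      refine FiniteMeasure.eq_of_forall_toMeasure_apply_eq _ _ fun A hA => ?_
      rw [toMeasure_sum, Measure.finsetSum_apply, toMeasure_map, Measure.map_apply s.measurable hA,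
        ← Measure.restrict_apply_univ, ← s.sum_range_measure_preimage_singleton]
      refine Finset.sum_congr rfl fun y _ => ?_
      have hy : ((diracProba y).toFiniteMeasure : Measure D) = Measure.dirac y := rfl
      rw [Measure.restrict_apply (s.measurableSet_preimage _), toMeasure_smul, hy,
        Measure.smul_apply, Measure.dirac_apply' _ hA, ENNReal.smul_def,
        ennreal_coeFn_eq_coeFn_toMeasure, smul_eq_mul]
      by_cases hyA : y ∈ A
      · have h : s ⁻¹' {y} ∩ s ⁻¹' A = s ⁻¹' {y} := by
          refine Set.inter_eq_left.2 (Set.preimage_mono (by simpa using hyA))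
        simp [h, hyA]
      · have h : s ⁻¹' {y} ∩ s ⁻¹' A = ∅ := by
          rw [← Set.preimage_inter, Set.singleton_inter_eq_empty.2 hyA, Set.preimage_empty]
        simp [h, hyA]
    rw [this]
    exact Finset.sum_induction _ p add zero fun y _ => smul_dirac _ _
  -- Simple functions tending pointwise to the identity: their images of `μ` are discrete and
  -- converge weakly to `μ`.
  let s (n : ℕ) : SimpleFunc D D :=
    SimpleFunc.approxOn id measurable_id Set.univ x₀ (Set.mem_univ _) n
  have hs (x : D) : Filter.Tendsto (fun n => s n x) Filter.atTop (nhds x) :=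
    SimpleFunc.tendsto_approxOn measurable_id (Set.mem_univ _) (by simp)
  refine hp.mem_of_tendsto (f := fun n => μ.map (s n)) (b := Filter.atTop) ?_
    (.of_forall fun n => hsimple (s n))
  rw [tendsto_iff_forall_integral_tendsto]
  intro f
  have hf (n : ℕ) : ∫ x, f x ∂(μ.map (s n) : Measure D) = ∫ x, f (s n x) ∂(μ : Measure D) :=
    integral_map (s n).measurable.aemeasurable f.continuous.aestronglyMeasurable
  simp_rw [hf]
  refine tendsto_integral_of_dominated_convergence (fun _ => ‖f‖)
    (fun n => (f.continuous.measurable.comp (s n).measurable).aestronglyMeasurable)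
    (integrable_const _) (fun n => .of_forall fun x => f.norm_coe_le_norm _)
    (.of_forall fun x => (f.continuous.tendsto x).comp (hs x))

variable {D : Type*} [MeasurableSpace D]

theorem toComplex_injective : Function.Injective (toComplex : FiniteMeasure D → _) := by
  intro μ ν h
  have := congrArg ComplexMeasure.re h
  exact toMeasure_injective (Measure.toSignedMeasure_eq_toSignedMeasure_iff.1 this)

theorem toComplex_apply (μ : FiniteMeasure D) {A : Set D} (hA : MeasurableSet A) :
    μ.toComplex A = (μ A : ℝ) := by
  rw [toComplex, SignedMeasure.toComplexMeasure_apply]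
  apply Complex.ext <;> simp [hA]

theorem toComplex_zero : (0 : FiniteMeasure D).toComplex = 0 := by
  ext A hA
  simp [toComplex_apply _ hA]

theorem toComplex_add (μ ν : FiniteMeasure D) :
    (μ + ν).toComplex = μ.toComplex + ν.toComplex := by
  ext A hA
  simp [toComplex_apply _ hA]

theorem toComplex_smul (c : NNReal) (μ : FiniteMeasure D) :
    (c • μ).toComplex = (c : ℂ) • μ.toComplex := by
  ext A hA
  simp [toComplex_apply _ hA]

end MeasureTheory.FiniteMeasure

/-- Every complex measure is a linear combination of four positive measures. -/
theorem MeasureTheory.ComplexMeasure.exists_eq_toComplex {D : Type*} [MeasurableSpace D]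
    (μ : ComplexMeasure D) : ∃ a b c d : FiniteMeasure D,
      μ = (a.toComplex - b.toComplex) + Complex.I • (c.toComplex - d.toComplex) := by
  let j := (ComplexMeasure.re μ).toJordanDecomposition
  let k := (ComplexMeasure.im μ).toJordanDecomposition
  refine ⟨⟨j.posPart, inferInstance⟩, ⟨j.negPart, inferInstance⟩, ⟨k.posPart, inferInstance⟩,
    ⟨k.negPart, inferInstance⟩, ?_⟩
  have hj : ComplexMeasure.re μ = j.posPart.toSignedMeasure - j.negPart.toSignedMeasure :=
    (SignedMeasure.toSignedMeasure_toJordanDecomposition _).symm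
  have hk : ComplexMeasure.im μ = k.posPart.toSignedMeasure - k.negPart.toSignedMeasure :=
    (SignedMeasure.toSignedMeasure_toJordanDecomposition _).symm
  rw [← μ.toComplexMeasure_to_signedMeasure, hj, hk]
  ext A hA
  apply Complex.ext <;>
    simp [FiniteMeasure.toComplex, SignedMeasure.toComplexMeasure_apply]

/-- Agreement on pairs of Dirac measures spreads to positive measures in one variable at a time, as
finite combinations of Dirac measures are weakly dense; complex measures follow by bilinearity. -/
theorem Hypergroup.conv_eq_of_diracConv_eq {D : Type*} [TopologicalSpace D] [T2Space D]
    [LocallyCompactSpace D] [SecondCountableTopology D] [MeasurableSpace D] [BorelSpace D]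
    {H H' : Hypergroup D} (h : H.diracConv = H'.diracConv) : H.conv = H'.conv := by
  obtain ⟨c, hc, hcH⟩ := H.conv_weakly_continuous
  obtain ⟨c', hc', hcH'⟩ := H'.conv_weakly_continuous
  have hiff (μ ν : FiniteMeasure D) : c (μ, ν) = c' (μ, ν) ↔
      H.conv μ.toComplex ν.toComplex = H'.conv μ.toComplex ν.toComplex := by
    rw [← hcH, ← hcH', FiniteMeasure.toComplex_injective.eq_iff]
  have hdirac (x : D) (ν : FiniteMeasure D) :
      c ((diracProba x).toFiniteMeasure, ν) = c' ((diracProba x).toFiniteMeasure, ν) := by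
    induction ν using FiniteMeasure.induction_of_dirac with
    | hp => exact isClosed_eq (by fun_prop) (by fun_prop)
    | zero => simp [hiff, FiniteMeasure.toComplex_zero]
    | add μ ν hμ hν =>
      rw [hiff] at *
      simp [FiniteMeasure.toComplex_add, hμ, hν]
    | smul_dirac r y =>
      rw [hiff]
      simp [FiniteMeasure.toComplex_smul, H.conv_dirac, H'.conv_dirac, h]
  have hpos (μ ν : FiniteMeasure D) : c (μ, ν) = c' (μ, ν) := by
    induction μ using FiniteMeasure.induction_of_dirac with
    | hp => exact isClosed_eq (by fun_prop) (by fun_prop)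
    | zero => simp [hiff, FiniteMeasure.toComplex_zero]
    | add μ μ' hμ hμ' =>
      rw [hiff] at *
      simp [FiniteMeasure.toComplex_add, hμ, hμ']
    | smul_dirac r x =>
      rw [hiff]
      simp [FiniteMeasure.toComplex_smul, (hiff _ _).1 (hdirac x ν)]
  simp_rw [hiff] at hpos
  refine LinearMap.ext fun μ => LinearMap.ext fun ν => ?_
  obtain ⟨a₁, a₂, a₃, a₄, rfl⟩ := μ.exists_eq_toComplex
  obtain ⟨b₁, b₂, b₃, b₄, rfl⟩ := ν.exists_eq_toComplex
  simp only [map_add, map_sub, map_smul, LinearMap.add_apply, LinearMap.sub_apply,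
    LinearMap.smul_apply, hpos]

/-! ### Uniqueness of the adjoint measure, the kernel and the hypergroup. -/

namespace IsContinuousAssociationScheme

variable {X D : Type*}
    [TopologicalSpace X] [T2Space X] [CompactSpace X] [SecondCountableTopology X]
    [MeasurableSpace X] [BorelSpace X]
    [TopologicalSpace D] [T2Space D] [CompactSpace D] [SecondCountableTopology D]
    [MeasurableSpace D] [BorelSpace D]
    {K K' : Kernel (X × D) X} {H H' : Hypergroup D} {π : X × X → D} {ω ω' : Measure X}

theorem eq_e [Nonempty X] (hK : IsContinuousAssociationScheme K H π)
    (hK' : IsContinuousAssociationScheme K' H' π) : H.e = H'.e := by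
  obtain ⟨x⟩ := ‹Nonempty X›
  rw [← hK.proj_self x, hK'.proj_self x]

theorem eq_bar [Nonempty X] (hK : IsContinuousAssociationScheme K H π)
    (hK' : IsContinuousAssociationScheme K' H' π) : H.bar = H'.bar := by
  obtain ⟨x⟩ := ‹Nonempty X›
  funext d
  obtain ⟨y, rfl⟩ := hK.proj_surjective x d
  exact (hK.proj_symm x y).symm.trans (hK'.proj_symm x y)

/-- Near the diagonal of `X × X`, which is `π ⁻¹' {e}`, a continuous function varies little. -/
theorem exists_isOpen_dist_lt (hK : IsContinuousAssociationScheme K H π)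
    (hπ : ∀ x y, π (x, y) = H.e → x = y) (f : C(X, ℝ)) {ε : ℝ} (hε : 0 < ε) :
    ∃ U : Set D, IsOpen U ∧ H.e ∈ U ∧ ∀ x y, π (x, y) ∈ U → |f x - f y| < ε := by
  have hC : IsClosed {p : X × X | ε ≤ |f p.1 - f p.2|} :=
    isClosed_le continuous_const (by fun_prop)
  refine ⟨(π '' {p : X × X | ε ≤ |f p.1 - f p.2|})ᶜ,
    (hC.isCompact.image hK.continuous_proj).isClosed.isOpen_compl, ?_, fun x y hxy => ?_⟩
  · rintro ⟨⟨x, y⟩, hp, hpe⟩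
    obtain rfl := hπ x y hpe
    simp only [sub_self, abs_zero, Set.mem_ofPred_eq] at hp
    exact hp.not_gt hε
  · by_contra! hle
    exact hxy ⟨(x, y), hle, rfl⟩

theorem eq_of_proj_eq_e (hK : IsContinuousAssociationScheme K H π) {x y : X}
    (h : π (x, y) = H.e) : x = y := by
  have hy : y ∈ (K (x, H.e)).support := (hK.mem_support_iff x y _).2 h.symm
  rw [hK.kernel_e] at hy
  by_contra hne
  have := (Measure.mem_support_iff_forall y).1 hy _ (isOpen_ne.mem_nhds (Ne.symm hne))
  simp at this

/-- Uniqueness of the adjoint measure, as a uniformly distributed measure. -/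
theorem adjointMeasure_unique [Nonempty X] (hK : IsContinuousAssociationScheme K H π)
    (hK' : IsContinuousAssociationScheme K' H' π) (hω : IsAdjointMeasure K H ω)
    (hω' : IsAdjointMeasure K' H' ω') : ω = ω' := by
  have := hω.isProbabilityMeasure
  have := hω'.isProbabilityMeasure
  refine ext_of_forall_integral_eq_of_IsFiniteMeasure fun f₀ => ?_
  obtain ⟨f, hf⟩ : ∃ f : C(X, ℝ), ∀ x, f₀ x = f x := ⟨f₀.toContinuousMap, fun _ => rfl⟩
  simp only [hf]
  refine eq_of_abs_sub_le_all fun ε hε => ?_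
  obtain ⟨U, hU, heU, hUf⟩ := hK.exists_isOpen_dist_lt (fun x y => hK.eq_of_proj_eq_e) f hε
  obtain ⟨φ, hφe, hφU, hφ⟩ := hU.exists_continuousMap_bump heU
  obtain ⟨x₀⟩ := ‹Nonempty X›
  set c := ∫ y, φ (π (x₀, y)) ∂ω with hc
  have hcx (x : X) : ∫ y, φ (π (x, y)) ∂ω = c := hK.integral_comp_proj_eq hω φ x x₀
  set c' := ∫ x, φ (H.bar (π (x₀, x))) ∂ω' with hc'
  -- Here `ω'` integrates the first variable of `π`; symmetry turns it into the second, where images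
  -- under `π (y, ·)` do not depend on `y`.
  have hcy (y : X) : ∫ x, φ (π (x, y)) ∂ω' = c' := by
    simp_rw [hK.proj_symm y]
    exact hK'.integral_comp_proj_eq hω' (φ.comp ⟨_, H.bar_continuous⟩) y x₀
  have hint {F : X × X → ℝ} (hF : Continuous F) : Integrable F (ω'.prod ω) :=
    ContinuousMap.integrable_of_compactSpace ⟨F, hF⟩
  have hπ := hK.continuous_proj
  have hswap {F : X → X → ℝ} (hF : Continuous (Function.uncurry F)) :
      ∫ x, ∫ y, F x y ∂ω ∂ω' = ∫ y, ∫ x, F x y ∂ω' ∂ω :=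
    integral_integral_swap (hint hF)
  have hcc : c = c' := by
    have h := hswap (F := fun x y => φ (π (x, y))) (φ.continuous.comp hπ)
    simpa [hcx, hcy] using h
  have hpos : 0 < c := by
    refine lt_of_le_of_ne (integral_nonneg fun y => hφ _) fun h0 => ?_
    have := ContinuousMap.eq_zero_of_integral_eq_zero (μ := ω) (x := x₀)
      (f := φ.comp ⟨_, hK.continuous_proj_right x₀⟩) (fun y => hφ _) h0.symm
      (by simp [hω.support_eq])
    simp [hK.proj_self, hφe] at this
  have hφπ : Continuous fun p : X × X => φ (π p) := φ.continuous.comp hπ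
  -- The weight `φ ∘ π` charges only pairs with `f x` within `ε` of `f y`, so the double integrals
  -- of `f y` and of `f x` against it differ by at most `c * ε`. They equal `c ∫ f dω` and `c ∫ f
  -- dω'`.
  have h₁ : ∫ x, ∫ y, φ (π (x, y)) * f y ∂ω ∂ω' = c * ∫ y, f y ∂ω := by
    rw [hswap (F := fun x y => φ (π (x, y)) * f y)
      (hφπ.mul (f.continuous.comp continuous_snd))]
    simp_rw [integral_mul_const, hcy, integral_const_mul, hcc]
  have h₂ : ∫ x, ∫ y, φ (π (x, y)) * f x ∂ω ∂ω' = c * ∫ x, f x ∂ω' := by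
    simp_rw [integral_mul_const, hcx, integral_const_mul]
  have hle (p : X × X) : ‖φ (π p) * f p.2 - φ (π p) * f p.1‖ ≤ φ (π p) * ε := by
    rw [Real.norm_eq_abs, ← mul_sub, abs_mul, abs_of_nonneg (hφ _)]
    by_cases hp : π p ∈ U
    · rw [abs_sub_comm]
      exact mul_le_mul_of_nonneg_left (hUf p.1 p.2 hp).le (hφ _)
    · simp [hφU _ hp]
  have hi₁ := hint (F := fun p => φ (π p) * f p.2)
    (hφπ.mul (f.continuous.comp continuous_snd))
  have hi₂ := hint (F := fun p => φ (π p) * f p.1)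
    (hφπ.mul (f.continuous.comp continuous_fst))
  have hi₃ := hint (F := fun p => φ (π p) * ε)
    (hφπ.mul continuous_const)
  have h₃ : |c * ∫ y, f y ∂ω - c * ∫ x, f x ∂ω'| ≤ c * ε := by
    rw [← h₁, ← h₂, ← integral_prod _ hi₁, ← integral_prod _ hi₂, ← integral_sub hi₁ hi₂]
    refine (norm_integral_le_of_norm_le hi₃ (.of_forall hle)).trans_eq ?_
    rw [integral_prod _ hi₃]
    simp_rw [integral_mul_const, hcx]
    simp
  rw [← mul_sub, abs_mul, abs_of_pos hpos] at h₃
  exact le_of_mul_le_mul_left h₃ hpos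

/-- A compact continuous association scheme is determined by its projection. -/
theorem kernel_unique [Nonempty X] (hK : IsContinuousAssociationScheme K H π)
    (hK' : IsContinuousAssociationScheme K' H' π) : K = K' := by
  obtain ⟨ω, hω⟩ := hK.exists_isAdjointMeasure
  obtain ⟨ω', hω'⟩ := hK'.exists_isAdjointMeasure
  obtain rfl := hK.adjointMeasure_unique hK' hω hω'
  have := hω.isProbabilityMeasure
  have := hK.isMarkovKernel
  have := hK'.isMarkovKernel
  ext1 ⟨x, d⟩
  refine ext_of_forall_integral_eq_of_IsFiniteMeasure fun f₀ => ?_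
  obtain ⟨f, hf⟩ : ∃ f : C(X, ℝ), ∀ x, f₀ x = f x := ⟨f₀.toContinuousMap, fun _ => rfl⟩
  simp only [hf]
  have hc : Continuous fun d => ∫ y, f y ∂(K (x, d)) :=
    (hK.continuous_integral_kernel f).comp (by fun_prop)
  have hc' : Continuous fun d => ∫ y, f y ∂(K' (x, d)) :=
    (hK'.continuous_integral_kernel f).comp (by fun_prop)
  -- Testing the two disintegrations of the same `ω` against the difference of the kernels itself
  -- makes the integral of its square zero.
  let φ : C(D, ℝ) := ⟨fun d => ∫ y, f y ∂(K (x, d)) - ∫ y, f y ∂(K' (x, d)), hc.sub hc'⟩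
  have h := (hK.integral_comp_proj_mul hω φ f x).symm.trans (hK'.integral_comp_proj_mul hω' φ f x)
  have hπ := hK.continuous_proj_right x
  have hφπ := φ.continuous.comp hπ
  have hi := ContinuousMap.integrable_of_compactSpace (μ := ω) ⟨_, hφπ.mul (hc.comp hπ)⟩
  have hi' := ContinuousMap.integrable_of_compactSpace (μ := ω) ⟨_, hφπ.mul (hc'.comp hπ)⟩
  have h0 : ∫ y, φ (π (x, y)) * φ (π (x, y)) ∂ω = 0 := by
    rw [← sub_eq_zero] at h
    rw [← h]
    refine Eq.trans ?_ (integral_sub hi hi')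
    refine integral_congr_ae (.of_forall fun y => ?_)
    exact mul_sub _ _ _
  obtain ⟨y, rfl⟩ := hK.proj_surjective x d
  have := ContinuousMap.eq_zero_of_integral_eq_zero (f := ⟨_, hφπ.mul hφπ⟩)
    (fun y => mul_self_nonneg _) h0 (x := y) (by simp [hω.support_eq])
  exact sub_eq_zero.1 (mul_self_eq_zero.1 this)

theorem hypergroup_unique [Nonempty X] (hK : IsContinuousAssociationScheme K H π)
    (hK' : IsContinuousAssociationScheme K H' π) : H = H' := by
  have hdirac : H.diracConv = H'.diracConv := by
    obtain ⟨x⟩ := ‹Nonempty X›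
    funext d d'
    refine Subtype.ext (Measure.ext fun B hB => ?_)
    exact (hK.diracConv_apply x d d' hB).trans (hK'.diracConv_apply x d d' hB).symm
  exact Hypergroup.ext (Hypergroup.conv_eq_of_diracConv_eq hdirac) hdirac (hK.eq_e hK')
    (hK.eq_bar hK')

end IsContinuousAssociationScheme

end

theorem corollary5p14 {X D : Type*}
    [TopologicalSpace X] [T2Space X] [CompactSpace X] [SecondCountableTopology X]
    [MeasurableSpace X] [BorelSpace X] [Nonempty X]
    [TopologicalSpace D] [T2Space D] [CompactSpace D] [SecondCountableTopology D]
    [MeasurableSpace D] [BorelSpace D]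
    (K K' : ProbabilityTheory.Kernel (X × D) X) (H H' : Hypergroup D) (π : X × X → D)
    (hK : IsContinuousAssociationScheme K H π)
    (hK' : IsContinuousAssociationScheme K' H' π) :
    K = K' ∧ H = H' := by
  obtain rfl := hK.kernel_unique hK'
  exact ⟨rfl, hK.hypergroup_unique hK'⟩
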